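/- Let $H_{\mathrm{logical}}\neq 0$ and $H_{\mathrm{comp}}$ be complex Hilbert spaces of arbitrary (possibly infinite) dimension. For a Hilbert space $H$, let $\mathbf L(H)$ be the bounded operators on $H$ with the operator norm $\|\cdot\|_\infty$, and let $\mathbf T(H)$ be the trace-class operators on $H$ with the norm $\|\rho\|_1=\operatorname{tr}|\rho|$, where $|\rho|=\sqrt{\rho^\dagger\rho}$. A density matrix is a positive $\rho\in\mathbf T(H)$ with $\operatorname{tr}\rho=1$. Let $P:\mathbf T(H_{\mathrm{comp}})\to\mathbf T(H_{\mathrm{comp}})$, $\mathcal M_{\mathrm{enc}}:\mathbf T(H_{\mathrm{logical}})\to\mathbf T(H_{\mathrm{comp}})$ and $\mathcal M_{\mathrm{dec}}:\mathbf T(H_{\mathrm{comp}})\to\mathbf T(H_{\mathrm{logical}})$ be completely positive trace-preserving linear maps, let $U$ be a unitary operator on $H_{\mathrm{logical}}$, and let $\alpha,\gamma\in\mathbb R$. Let $P^{\mathrm t}:\mathbf L(H_{\mathrm{comp}})\to\mathbf L(H_{\mathrm{comp}})$ be the dual map, determined by $\operatorname{tr}(P^{\mathrm t}(T)\rho)=\operatorname{tr}(T\,P(\rho))$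 for all $T\in\mathbf L(H_{\mathrm{comp}})$ and $\rho\in\mathbf T(H_{\mathrm{comp}})$. Suppose that: 1. (the Quantum Computer Condition $\mathbf{QCC}(P,U,\mathcal M_{\mathrm{enc}},\mathcal M_{\mathrm{dec}},\alpha)$) for all density matrices $\rho\in\mathbf T(H_{\mathrm{logical}})$, $$\bigl\|\mathcal M_{\mathrm{dec}}(P(\mathcal M_{\mathrm{enc}}(\rho)))-U\rho U^\dagger\bigr\|_1\le\alpha;$$ 2. ($P$ is $\gamma$-damped) there is an abelian von Neumann algebra $\mathfrak A\subseteq\mathbf L(H_{\mathrm{comp}})$ such that for every $T\in\mathbf L(H_{\mathrm{comp}})$ there is an $S_T\in\mathfrak A$ with $\|P^{\mathrm t}(T)-S_T\|_\infty\le\gamma\,\|T\|_\infty$; 3. $2\gamma+\alpha<\sqrt2/4$. Then $H_{\mathrm{logical}}$ has dimension $1$. -/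

import Mathlib

namespace QuantumComputer

open scoped InnerProductSpace ComplexOrder

universe u v

section TraceClass

lemma inner_nonneg_of_nonneg {H : Type u} [NormedAddCommGroup H] [InnerProductSpace ℂ H]
    {A : H →L[ℂ] H} (hA : 0 ≤ A) (x : H) :
    0 ≤ (⟪x, A x⟫_ℂ).re :=
  ((ContinuousLinearMap.nonneg_iff_isPositive A).1 hA).re_inner_nonneg_right x

variable (H : Type u) [NormedAddCommGroup H] [InnerProductSpace ℂ H] [CompleteSpace H]

/-- The index set of the Hilbert basis `hbasis H`. -/
def BasisIndex : Set H := (exists_hilbertBasis ℂ H).choose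

/-- A fixed Hilbert basis (complete orthonormal system) of `H`, of whatever cardinality `H`
requires. Traces and trace norms do not depend on it. -/
noncomputable def hbasis : HilbertBasis (BasisIndex H) ℂ H :=
  (exists_hilbertBasis ℂ H).choose_spec.choose

variable {H}

/-- `T` is trace class: `tr |T| = ∑ᵢ ⟪eᵢ, |T| eᵢ⟫ < ∞`, where `|T| = √(T† T)`. -/
def IsTraceClass (T : H →L[ℂ] H) : Prop :=
  Summable fun i => (⟪hbasis H i, CFC.abs T (hbasis H i)⟫_ℂ).re

/-- `tr |T|` for a trace-class operator `T`. -/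
noncomputable def trAbs (T : H →L[ℂ] H) : ℝ :=
  ∑' i, (⟪hbasis H i, CFC.abs T (hbasis H i)⟫_ℂ).re

lemma trAbs_nonneg (T : H →L[ℂ] H) : 0 ≤ trAbs T :=
  tsum_nonneg fun _ => inner_nonneg_of_nonneg (CFC.abs_nonneg T) _

lemma inner_eq_norm_sqrt {A : H →L[ℂ] H} (hA : 0 ≤ A) (x y : H) :
    ⟪x, A y⟫_ℂ = ⟪CFC.sqrt A x, CFC.sqrt A y⟫_ℂ := by
  have h1 : CFC.sqrt A * CFC.sqrt A = A := CFC.sqrt_mul_sqrt_self A hA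
  have h2 : IsSelfAdjoint (CFC.sqrt A) := .of_nonneg (CFC.sqrt_nonneg A)
  conv_lhs => rw [← h1]
  rw [mul_apply_eq_comp, ← ContinuousLinearMap.adjoint_inner_left, h2.adjoint_eq]

lemma inner_re_eq_norm_sq {A : H →L[ℂ] H} (hA : 0 ≤ A) (x : H) :
    (⟪x, A x⟫_ℂ).re = ‖CFC.sqrt A x‖ ^ 2 := by
  rw [inner_eq_norm_sqrt hA, inner_self_eq_norm_sq_to_K]
  norm_cast

lemma hs_bound {A : H →L[ℂ] H} (hA : IsSelfAdjoint A)
    (hs : Summable fun i => ‖A (hbasis H i)‖ ^ 2) (Y : H →L[ℂ] H) (F : Finset (BasisIndex H)) :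
    ∑ i ∈ F, ‖A (Y (hbasis H i))‖ ^ 2 ≤ ‖Y‖ ^ 2 * ∑' i, ‖A (hbasis H i)‖ ^ 2 := by
  set b := hbasis H
  have key : HasSum (fun j => ∑ i ∈ F, ‖⟪b j, A (Y (b i))⟫_ℂ‖ ^ 2)
      (∑ i ∈ F, ‖A (Y (b i))‖ ^ 2) := by
    refine hasSum_sum fun i _ => ?_
    have := b.hasSum_inner_mul_inner (A (Y (b i))) (A (Y (b i)))
    have h2 := Complex.hasSum_re this
    have h3 : (⟪A (Y (b i)), A (Y (b i))⟫_ℂ).re = ‖A (Y (b i))‖ ^ 2 := by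
      rw [inner_self_eq_norm_sq_to_K]; norm_cast
    rw [h3] at h2
    refine h2.congr_fun fun j => ?_
    rw [← inner_conj_symm (A (Y (b i))) (b j), Complex.conj_mul']
    norm_cast
  have h1 : ∀ j, ∑ i ∈ F, ‖⟪b j, A (Y (b i))⟫_ℂ‖ ^ 2 ≤ ‖Y‖ ^ 2 * ‖A (b j)‖ ^ 2 := by
    intro j
    have e : ∀ i, ‖⟪b j, A (Y (b i))⟫_ℂ‖ = ‖⟪b i, ContinuousLinearMap.adjoint Y (A (b j))⟫_ℂ‖ := by
      intro i
      rw [ContinuousLinearMap.adjoint_inner_right, ← ContinuousLinearMap.adjoint_inner_left,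
        hA.adjoint_eq, norm_inner_symm]
    simp_rw [e]
    refine (b.orthonormal.sum_inner_products_le _).trans ?_
    rw [← mul_pow]
    gcongr
    refine ((ContinuousLinearMap.adjoint Y).le_opNorm _).trans ?_
    rw [LinearIsometryEquiv.norm_map]
  rw [← key.tsum_eq, ← tsum_mul_left]
  exact key.summable.tsum_le_tsum h1 (hs.mul_left _)

/-- Approximate polar decomposition. -/
lemma exists_polar (T : H →L[ℂ] H) {ε : ℝ} (hε : 0 < ε) :
    ∃ W : H →L[ℂ] H, ‖W‖ ≤ 1 ∧ ‖W * CFC.abs T - T‖ ≤ ε ∧ ‖star W * T - CFC.abs T‖ ≤ ε := by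
  have haa : CFC.abs T * CFC.abs T = star T * T := CFC.abs_mul_abs T
  have ha0 : 0 ≤ CFC.abs T := CFC.abs_nonneg T
  generalize CFC.abs T = a at haa ha0 ⊢
  have hsa : IsSelfAdjoint a := .of_nonneg ha0
  have hspec : ∀ x ∈ spectrum ℝ a, 0 ≤ x := fun x hx => spectrum_nonneg_of_nonneg ha0 hx
  obtain ⟨f, hfc, hf⟩ : ∃ f : ℝ → ℝ, Continuous f ∧ ∀ x, 0 ≤ x → f x = (x + ε)⁻¹ := by
    refine ⟨fun x => (|x| + ε)⁻¹, Continuous.inv₀ (by fun_prop) fun x => by positivity, ?_⟩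
    intro x hx
    simp only [abs_of_nonneg hx]
  have hcs : IsSelfAdjoint (cfc f a) := cfc_predicate f a
  have hid : cfc (fun x : ℝ => x) a = a := cfc_id' ℝ a
  have hca : cfc f a * a = cfc (fun x => f x * x) a := by
    rw [cfc_mul f (fun x => x) a hfc.continuousOn continuousOn_id, hid]
  have hac : a * cfc f a = cfc (fun x => x * f x) a := by
    rw [cfc_mul (fun x => x) f a continuousOn_id hfc.continuousOn, hid]
  have h2 : a * (cfc f a * a - 1) = cfc (fun x => x * (f x * x - 1)) a := by
    rw [cfc_mul (fun x => x) (fun x => f x * x - 1) a continuousOn_id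
      (by fun_prop), hid, cfc_sub (fun x => f x * x) (fun _ => 1) a (by fun_prop) (by fun_prop),
      ← hca, cfc_const_one ℝ a]
  have h3 : cfc f a * a * a - a = cfc (fun x => f x * x * x - x) a := by
    rw [cfc_sub (fun x => f x * x * x) (fun x => x) a (by fun_prop) (by fun_prop),
      cfc_mul (fun x => f x * x) (fun x => x) a (by fun_prop) (by fun_prop), hid, hca]
  have hnorm : ∀ X : H →L[ℂ] H, ‖T * X‖ = ‖a * X‖ := by
    intro X
    have h1 : star (T * X) * (T * X) = star (a * X) * (a * X) := by
      rw [star_mul, star_mul, hsa.star_eq, mul_assoc, mul_assoc, ← mul_assoc (star T),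
        ← mul_assoc a, haa]
    have h2 := CStarRing.norm_star_mul_self (x := T * X)
    have h3 := CStarRing.norm_star_mul_self (x := a * X)
    rw [h1, h3] at h2
    exact (mul_self_inj (norm_nonneg _) (norm_nonneg _)).1 h2.symm
  refine ⟨T * cfc f a, ?_, ?_, ?_⟩
  · rw [hnorm, hac]
    refine norm_cfc_le zero_le_one fun x hx => ?_
    have := hspec x hx
    rw [hf x this, Real.norm_eq_abs, abs_of_nonneg (by positivity), ← div_eq_mul_inv,
      div_le_one (by positivity)]
    linarith
  · have : T * cfc f a * a - T = T * (cfc f a * a - 1) := by rw [mul_sub, mul_one, mul_assoc]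
    rw [this, hnorm, h2]
    refine norm_cfc_le hε.le fun x hx => ?_
    have := hspec x hx
    have e : x * (f x * x - 1) = - (x / (x + ε) * ε) := by
      rw [hf x this]
      field_simp
      ring
    rw [e, norm_neg, Real.norm_eq_abs, abs_of_nonneg (by positivity)]
    have : x / (x + ε) ≤ 1 := by rw [div_le_one (by positivity)]; linarith
    nlinarith
  · rw [star_mul, hcs.star_eq, mul_assoc, ← haa, ← mul_assoc, h3]
    refine norm_cfc_le hε.le fun x hx => ?_
    have := hspec x hx
    have e : f x * x * x - x = - (x / (x + ε) * ε) := by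
      rw [hf x this]
      field_simp
      ring
    rw [e, norm_neg, Real.norm_eq_abs, abs_of_nonneg (by positivity)]
    have : x / (x + ε) ≤ 1 := by rw [div_le_one (by positivity)]; linarith
    nlinarith

lemma sum_inner_le {T : H →L[ℂ] H} (hT : IsTraceClass T) (X Y : H →L[ℂ] H)
    (F : Finset (BasisIndex H)) :
    ∑ i ∈ F, ‖⟪hbasis H i, X (T (Y (hbasis H i)))⟫_ℂ‖ ≤ ‖X‖ * ‖Y‖ * trAbs T := by
  set b := hbasis H
  have ha0 := CFC.abs_nonneg T
  set A := CFC.sqrt (CFC.abs T) with hA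
  have hAs : IsSelfAdjoint A := .of_nonneg (CFC.sqrt_nonneg _)
  have hsum : Summable fun i => ‖A (b i)‖ ^ 2 := by
    refine Summable.congr hT fun i => ?_
    exact inner_re_eq_norm_sq ha0 _
  have htr : ∑' i, ‖A (b i)‖ ^ 2 = trAbs T := by
    refine tsum_congr fun i => ?_
    exact (inner_re_eq_norm_sq ha0 _).symm
  have h0 := trAbs_nonneg T
  refine le_of_forall_pos_le_add fun δ hδ => ?_
  set N : ℝ := ‖X‖ * ‖Y‖ * F.card + 1 with hN
  have hNpos : 0 < N := by positivity
  obtain ⟨W, hW1, hW2, -⟩ := exists_polar T (div_pos hδ hNpos)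
  have step1 : ∀ i, ‖⟪b i, X (T (Y (b i)))⟫_ℂ‖ ≤
      ‖A (star (X * W) (b i))‖ * ‖A (Y (b i))‖ + ‖X‖ * ‖Y‖ * (δ / N) := by
    intro i
    have e : ⟪b i, X (T (Y (b i)))⟫_ℂ = ⟪A (star (X * W) (b i)), A (Y (b i))⟫_ℂ
        - ⟪b i, X ((W * CFC.abs T - T) (Y (b i)))⟫_ℂ := by
      rw [← inner_eq_norm_sqrt ha0, ContinuousLinearMap.star_eq_adjoint,
        ContinuousLinearMap.adjoint_inner_left, ← inner_sub_right]
      simp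
    rw [e]
    refine (norm_sub_le _ _).trans (add_le_add (norm_inner_le_norm _ _) ?_)
    refine (norm_inner_le_norm _ _).trans ?_
    rw [b.orthonormal.1 i, one_mul]
    refine (X.le_opNorm _).trans ?_
    rw [mul_assoc]
    gcongr
    refine ((W * CFC.abs T - T).le_opNorm _).trans ?_
    rw [mul_comm]
    gcongr
    refine (Y.le_opNorm _).trans ?_
    rw [b.orthonormal.1 i, mul_one]
  refine (Finset.sum_le_sum fun i _ => step1 i).trans ?_
  rw [Finset.sum_add_distrib]
  refine add_le_add ?_ ?_
  · refine (Real.sum_mul_le_sqrt_mul_sqrt F _ _).trans ?_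
    have b1 := hs_bound hAs hsum (star (X * W)) F
    have b2 := hs_bound hAs hsum Y F
    rw [htr] at b1 b2
    have b3 : ‖star (X * W)‖ ≤ ‖X‖ := by
      rw [norm_star]
      exact (norm_mul_le _ _).trans (mul_le_of_le_one_right (norm_nonneg _) hW1)
    have b1' : ∑ i ∈ F, ‖A (star (X * W) (b i))‖ ^ 2 ≤ ‖X‖ ^ 2 * trAbs T :=
      b1.trans (by gcongr)
    calc _ ≤ √(‖X‖ ^ 2 * trAbs T) * √(‖Y‖ ^ 2 * trAbs T) := by gcongr
      _ = ‖X‖ * ‖Y‖ * trAbs T := by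
        rw [Real.sqrt_mul (by positivity), Real.sqrt_mul (by positivity),
          Real.sqrt_sq (norm_nonneg _), Real.sqrt_sq (norm_nonneg _)]
        have := Real.mul_self_sqrt h0
        linear_combination (‖X‖ * ‖Y‖) * this
  · rw [Finset.sum_const, nsmul_eq_mul]
    rw [show (F.card : ℝ) * (‖X‖ * ‖Y‖ * (δ / N)) = (‖X‖ * ‖Y‖ * F.card) * δ / N by ring,
      div_le_iff₀ hNpos]
    nlinarith

lemma isTraceClass_of_bound {R : H →L[ℂ] H} (C : ℝ)
    (h : ∀ (V : H →L[ℂ] H) (F : Finset (BasisIndex H)), ‖V‖ ≤ 1 →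
      ∑ i ∈ F, ‖⟪hbasis H i, V (R (hbasis H i))⟫_ℂ‖ ≤ C) :
    IsTraceClass R ∧ trAbs R ≤ C := by
  set b := hbasis H
  have hb : ∀ F : Finset (BasisIndex H), ∑ i ∈ F, (⟪b i, CFC.abs R (b i)⟫_ℂ).re ≤ C := by
    intro F
    refine le_of_forall_pos_le_add fun δ hδ => ?_
    have hN : (0 : ℝ) < F.card + 1 := by positivity
    obtain ⟨W, hW1, -, hW2⟩ := exists_polar R (div_pos hδ hN)
    have step : ∀ i, (⟪b i, CFC.abs R (b i)⟫_ℂ).re ≤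
        ‖⟪b i, star W (R (b i))⟫_ℂ‖ + δ / (F.card + 1) := by
      intro i
      have e : ⟪b i, CFC.abs R (b i)⟫_ℂ =
          ⟪b i, star W (R (b i))⟫_ℂ - ⟪b i, (star W * R - CFC.abs R) (b i)⟫_ℂ := by
        rw [← inner_sub_right]; simp
      refine (Complex.re_le_norm _).trans ?_
      rw [e]
      refine (norm_sub_le _ _).trans (add_le_add le_rfl ?_)
      refine (norm_inner_le_norm _ _).trans ?_
      rw [b.orthonormal.1 i, one_mul]
      refine ((star W * R - CFC.abs R).le_opNorm _).trans ?_
      rwa [b.orthonormal.1 i, mul_one]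
    refine (Finset.sum_le_sum fun i _ => step i).trans ?_
    rw [Finset.sum_add_distrib]
    refine add_le_add (h _ F (by rwa [norm_star])) ?_
    rw [Finset.sum_const, nsmul_eq_mul, ← mul_div_assoc, div_le_iff₀ hN]
    nlinarith
  have hnn : ∀ i, 0 ≤ (⟪b i, CFC.abs R (b i)⟫_ℂ).re :=
    fun i => inner_nonneg_of_nonneg (CFC.abs_nonneg R) _
  exact ⟨summable_of_sum_le hnn hb, Real.tsum_le_of_sum_le hnn hb⟩

lemma IsTraceClass.mul_mul {T : H →L[ℂ] H} (hT : IsTraceClass T) (X Y : H →L[ℂ] H) :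
    IsTraceClass (X * T * Y) := by
  refine (isTraceClass_of_bound (‖X‖ * ‖Y‖ * trAbs T) fun V F hV => ?_).1
  refine (sum_inner_le hT (V * X) Y F).trans ?_
  have := trAbs_nonneg T
  gcongr
  exact (norm_mul_le _ _).trans (mul_le_of_le_one_left (norm_nonneg _) hV)

lemma IsTraceClass.mul_left {T : H →L[ℂ] H} (hT : IsTraceClass T) (X : H →L[ℂ] H) :
    IsTraceClass (X * T) := by
  simpa using hT.mul_mul X 1

lemma IsTraceClass.add {S T : H →L[ℂ] H} (hS : IsTraceClass S) (hT : IsTraceClass T) :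
    IsTraceClass (S + T) := by
  refine (isTraceClass_of_bound (trAbs S + trAbs T) fun V F hV => ?_).1
  have h1 := sum_inner_le hS V 1 F
  have h2 := sum_inner_le hT V 1 F
  have n1 : ‖(1 : H →L[ℂ] H)‖ ≤ 1 := ContinuousLinearMap.norm_id_le
  have n2 : ‖V‖ * ‖(1 : H →L[ℂ] H)‖ ≤ 1 := mul_le_one₀ hV (norm_nonneg _) n1
  have h1' := h1.trans (mul_le_of_le_one_left (trAbs_nonneg S) n2)
  have h2' := h2.trans (mul_le_of_le_one_left (trAbs_nonneg T) n2)
  refine le_trans ?_ (add_le_add h1' h2')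
  rw [← Finset.sum_add_distrib]
  refine Finset.sum_le_sum fun i _ => ?_
  simp only [add_apply, map_add, inner_add_right,
    one_apply_eq_self]
  exact norm_add_le _ _

lemma IsTraceClass.smul {T : H →L[ℂ] H} (hT : IsTraceClass T) (c : ℂ) :
    IsTraceClass (c • T) := by
  simpa using hT.mul_left (c • (1 : H →L[ℂ] H))

lemma isTraceClass_zero : IsTraceClass (0 : H →L[ℂ] H) := by
  unfold IsTraceClass
  simp

lemma IsTraceClass.star {T : H →L[ℂ] H} (hT : IsTraceClass T) : IsTraceClass (star T) := by
  refine (isTraceClass_of_bound (trAbs T) fun V F hV => ?_).1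
  have h1 := sum_inner_le hT 1 (Star.star V) F
  have n1 : ‖(1 : H →L[ℂ] H)‖ ≤ 1 := ContinuousLinearMap.norm_id_le
  have n2 : ‖(1 : H →L[ℂ] H)‖ * ‖Star.star V‖ ≤ 1 := by
    rw [norm_star]
    exact mul_le_one₀ n1 (norm_nonneg _) hV
  refine le_trans (le_of_eq ?_) (h1.trans (mul_le_of_le_one_left (trAbs_nonneg T) n2))
  refine Finset.sum_congr rfl fun i _ => ?_
  rw [norm_inner_symm, ContinuousLinearMap.star_eq_adjoint, ContinuousLinearMap.star_eq_adjoint,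
    one_apply_eq_self, ← ContinuousLinearMap.adjoint_inner_right,
    ← ContinuousLinearMap.adjoint_inner_left, ContinuousLinearMap.adjoint_inner_left,
    ContinuousLinearMap.adjoint_inner_left]

variable (H) in
/-- The space `T(H)` of trace-class operators on `H`. -/
def TraceClass : Submodule ℂ (H →L[ℂ] H) where
  carrier := {T | IsTraceClass T}
  add_mem' := IsTraceClass.add
  zero_mem' := isTraceClass_zero
  smul_mem' c _ h := h.smul c

/-- The trace `tr ρ = ∑ᵢ ⟪eᵢ, ρ eᵢ⟫` of a trace-class operator. -/
noncomputable def trace (ρ : TraceClass H) : ℂ :=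
  ∑' i, ⟪hbasis H i, (ρ : H →L[ℂ] H) (hbasis H i)⟫_ℂ

/-- The Schatten 1-norm `‖ρ‖₁ = tr |ρ|` of a trace-class operator. -/
noncomputable def traceNorm (ρ : TraceClass H) : ℝ := trAbs (ρ : H →L[ℂ] H)

lemma summable_trace (X : H →L[ℂ] H) (ρ : TraceClass H) :
    Summable fun i => ‖⟪hbasis H i, X ((ρ : H →L[ℂ] H) (hbasis H i))⟫_ℂ‖ :=
  summable_of_sum_le (fun _ => norm_nonneg _) fun F => sum_inner_le ρ.2 X 1 F

lemma summable_trace_self (ρ : TraceClass H) :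
    Summable fun i => ⟪hbasis H i, (ρ : H →L[ℂ] H) (hbasis H i)⟫_ℂ :=
  (summable_trace 1 ρ).of_norm

lemma trace_add (ρ σ : TraceClass H) : trace (ρ + σ) = trace ρ + trace σ := by
  unfold trace
  rw [← (summable_trace_self ρ).tsum_add (summable_trace_self σ)]
  simp

lemma trace_smul (c : ℂ) (ρ : TraceClass H) : trace (c • ρ) = c * trace ρ := by
  unfold trace
  rw [← tsum_mul_left]
  simp

/-- The product `X ρ` of a bounded and a trace-class operator, which is trace class. -/
def mulLeft (X : H →L[ℂ] H) : TraceClass H →ₗ[ℂ] TraceClass H where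
  toFun ρ := ⟨X * ρ, ρ.2.mul_left X⟩
  map_add' ρ σ := Subtype.ext (mul_add X ρ σ)
  map_smul' c ρ := Subtype.ext (mul_smul_comm c X (ρ : H →L[ℂ] H))

/-- `X ρ X†` for a bounded operator `X` and a trace-class operator `ρ`. -/
noncomputable def conj (X : H →L[ℂ] H) (ρ : TraceClass H) : TraceClass H :=
  ⟨X * ρ * star X, ρ.2.mul_mul X (star X)⟩

lemma norm_trace_mulLeft_le (X : H →L[ℂ] H) (ρ : TraceClass H) :
    ‖trace (mulLeft X ρ)‖ ≤ ‖X‖ * traceNorm ρ := by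
  refine tsum_of_norm_bounded (summable_trace X ρ).hasSum (fun i => le_rfl) |>.trans ?_
  refine Real.tsum_le_of_sum_le (fun _ => norm_nonneg _) fun F => ?_
  refine (sum_inner_le ρ.2 X 1 F).trans ?_
  have n1 : ‖(1 : H →L[ℂ] H)‖ ≤ 1 := ContinuousLinearMap.norm_id_le
  exact mul_le_mul_of_nonneg_right (mul_le_of_le_one_right (norm_nonneg _) n1) (trAbs_nonneg _)

lemma traceNorm_of_nonneg {ρ : TraceClass H} (hρ : 0 ≤ (ρ : H →L[ℂ] H)) :
    traceNorm ρ = (trace ρ).re := by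
  unfold traceNorm trAbs trace
  rw [CFC.abs_of_nonneg _ hρ, Complex.re_tsum (summable_trace_self ρ)]

lemma isTraceClass_rankOne (y x : H) : IsTraceClass (InnerProductSpace.rankOne ℂ y x) := by
  refine (isTraceClass_of_bound (‖y‖ * ‖x‖) fun V F hV => ?_).1
  have h1 : ∑ i ∈ F, ‖⟪hbasis H i, V y⟫_ℂ‖ ^ 2 ≤ ‖y‖ ^ 2 := by
    refine ((hbasis H).orthonormal.sum_inner_products_le _).trans ?_
    gcongr
    exact (V.le_opNorm y).trans (mul_le_of_le_one_left (norm_nonneg _) hV)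
  have h2 : ∑ i ∈ F, ‖⟪hbasis H i, x⟫_ℂ‖ ^ 2 ≤ ‖x‖ ^ 2 :=
    (hbasis H).orthonormal.sum_inner_products_le _
  calc ∑ i ∈ F, ‖⟪hbasis H i, V (InnerProductSpace.rankOne ℂ y x (hbasis H i))⟫_ℂ‖
      = ∑ i ∈ F, ‖⟪hbasis H i, V y⟫_ℂ‖ * ‖⟪hbasis H i, x⟫_ℂ‖ := by
        refine Finset.sum_congr rfl fun i _ => ?_
        rw [InnerProductSpace.rankOne_apply, map_smul, inner_smul_right, norm_mul, mul_comm,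
          norm_inner_symm x]
    _ ≤ √(∑ i ∈ F, ‖⟪hbasis H i, V y⟫_ℂ‖ ^ 2) * √(∑ i ∈ F, ‖⟪hbasis H i, x⟫_ℂ‖ ^ 2) :=
        Real.sum_mul_le_sqrt_mul_sqrt F _ _
    _ ≤ √(‖y‖ ^ 2) * √(‖x‖ ^ 2) := by gcongr
    _ = ‖y‖ * ‖x‖ := by rw [Real.sqrt_sq (norm_nonneg _), Real.sqrt_sq (norm_nonneg _)]

/-- The rank-one operator `|y⟩⟨x|` as a trace-class operator. -/
noncomputable def ketBra (y x : H) : TraceClass H :=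
  ⟨InnerProductSpace.rankOne ℂ y x, isTraceClass_rankOne y x⟩

lemma trace_ketBra (y x : H) : trace (ketBra y x) = ⟪x, y⟫_ℂ := by
  rw [← (hbasis H).tsum_inner_mul_inner]
  refine tsum_congr fun i => ?_
  change ⟪hbasis H i, InnerProductSpace.rankOne ℂ y x (hbasis H i)⟫_ℂ = _
  rw [InnerProductSpace.rankOne_apply, inner_smul_right]

lemma mulLeft_ketBra (X : H →L[ℂ] H) (y x : H) : mulLeft X (ketBra y x) = ketBra (X y) x := by
  refine Subtype.ext (ContinuousLinearMap.ext fun z => ?_)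
  change X (InnerProductSpace.rankOne ℂ y x z) = InnerProductSpace.rankOne ℂ (X y) x z
  simp

lemma ketBra_self_nonneg (x : H) : 0 ≤ (ketBra x x : H →L[ℂ] H) :=
  (ContinuousLinearMap.nonneg_iff_isPositive _).2 (InnerProductSpace.isPositive_rankOne_self x)

/-- A linear functional on `T(H)` that vanishes on rank-one projections and is dominated by the
trace on positive operators is zero. -/
lemma functional_eq_zero (ψ : TraceClass H →ₗ[ℂ] ℂ) (C : ℝ)
    (hψ : ∀ ρ : TraceClass H, 0 ≤ (ρ : H →L[ℂ] H) → ‖ψ ρ‖ ≤ C * (trace ρ).re)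
    (h0 : ∀ x, ψ (ketBra x x) = 0) (ρ : TraceClass H) : ψ ρ = 0 := by
  have hpos : ∀ ρ : TraceClass H, 0 ≤ (ρ : H →L[ℂ] H) → ψ ρ = 0 := by
    intro ρ hρ
    set b := hbasis H
    set A := CFC.sqrt (ρ : H →L[ℂ] H) with hA
    have hAs : IsSelfAdjoint A := .of_nonneg (CFC.sqrt_nonneg _)
    have hsum : HasSum (fun i => ‖A (b i)‖ ^ 2) (trace ρ).re := by
      have h1 := Complex.hasSum_re (summable_trace 1 ρ).of_norm.hasSum
      refine h1.congr_fun fun i => ?_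
      exact (inner_re_eq_norm_sq hρ (b i)).symm
    have hbd : ∀ F : Finset (BasisIndex H),
        ‖ψ ρ‖ ≤ C * ((trace ρ).re - ∑ i ∈ F, ‖A (b i)‖ ^ 2) := by
      intro F
      set σ : TraceClass H := ρ - ∑ i ∈ F, ketBra (A (b i)) (A (b i)) with hσ
      have hσc : (σ : H →L[ℂ] H) = (ρ : H →L[ℂ] H) -
          ∑ i ∈ F, InnerProductSpace.rankOne ℂ (A (b i)) (A (b i)) := by
        rw [hσ, Submodule.coe_sub, Submodule.coe_sum]; rfl
      have hσ0 : 0 ≤ (σ : H →L[ℂ] H) := by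
        rw [ContinuousLinearMap.nonneg_iff_isPositive]
        have hsa : IsSelfAdjoint (σ : H →L[ℂ] H) := by
          rw [hσc]
          refine (IsSelfAdjoint.of_nonneg hρ).sub (isSelfAdjoint_sum _ fun i _ => ?_)
          exact (InnerProductSpace.isPositive_rankOne_self _).isSelfAdjoint
        refine (ContinuousLinearMap.isPositive_def'.2 ⟨hsa, fun x => ?_⟩)
        rw [ContinuousLinearMap.reApplyInnerSelf_apply, ← inner_conj_symm, RCLike.conj_re]
        have e : ⟪x, (σ : H →L[ℂ] H) x⟫_ℂ =
            ⟪x, (ρ : H →L[ℂ] H) x⟫_ℂ - ∑ i ∈ F, (‖⟪b i, A x⟫_ℂ‖ ^ 2 : ℝ) := by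
          rw [hσc, sub_apply, inner_sub_right, sum_apply, inner_sum,
            Complex.ofReal_sum]
          congr 1
          refine Finset.sum_congr rfl fun i _ => ?_
          rw [InnerProductSpace.rankOne_apply, inner_smul_right, mul_comm]
          have : ⟪A (b i), x⟫_ℂ = ⟪b i, A x⟫_ℂ := by
            rw [← ContinuousLinearMap.adjoint_inner_right, hAs.adjoint_eq]
          rw [this, ← inner_conj_symm x, this, Complex.conj_mul']
          norm_cast
        rw [e]
        rw [RCLike.re_eq_complex_re, Complex.sub_re, Complex.ofReal_re, inner_re_eq_norm_sq hρ, sub_nonneg]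
        exact b.orthonormal.sum_inner_products_le _
      have h1 : ψ σ = ψ ρ := by
        rw [hσ, map_sub, map_sum]
        simp [h0]
      have h2 : trace σ = trace ρ - ∑ i ∈ F, (‖A (b i)‖ ^ 2 : ℝ) := by
        have h3 : ∀ F : Finset (BasisIndex H), trace (∑ i ∈ F, ketBra (A (b i)) (A (b i))) =
            ∑ i ∈ F, ((‖A (b i)‖ ^ 2 : ℝ) : ℂ) := by
          classical
          intro F
          induction F using Finset.induction_on with
          | empty => simp [trace]
          | insert i F hi ih =>
            rw [Finset.sum_insert hi, Finset.sum_insert hi, trace_add, ih, trace_ketBra,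
              inner_self_eq_norm_sq_to_K, Complex.ofReal_pow]
            rfl
        have h4 : trace σ + trace (∑ i ∈ F, ketBra (A (b i)) (A (b i))) = trace ρ := by
          rw [← trace_add, hσ, sub_add_cancel]
        rw [← h4, h3, Complex.ofReal_sum]; ring
      have h5 := hψ σ hσ0
      rw [h1, h2] at h5
      rwa [Complex.sub_re, Complex.ofReal_re] at h5
    have hlim : Filter.Tendsto (fun F : Finset (BasisIndex H) =>
        C * ((trace ρ).re - ∑ i ∈ F, ‖A (b i)‖ ^ 2)) Filter.atTop (nhds 0) := by
      have : Filter.Tendsto (fun F : Finset (BasisIndex H) =>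
        C * ((trace ρ).re - ∑ i ∈ F, ‖A (b i)‖ ^ 2)) Filter.atTop
          (nhds (C * ((trace ρ).re - (trace ρ).re))) := (hsum.const_sub _).const_mul C
      simpa using this
    have := ge_of_tendsto' hlim hbd
    exact norm_le_zero_iff.1 this
  have hself : ∀ ρ : TraceClass H, IsSelfAdjoint (ρ : H →L[ℂ] H) → ψ ρ = 0 := by
    intro ρ hρ
    have ha : IsTraceClass (CFC.abs (ρ : H →L[ℂ] H)) := by
      have := ρ.2
      unfold IsTraceClass
      rw [CFC.cfcAbs_cfcAbs]
      exact this
    set τ : TraceClass H := ⟨CFC.abs (ρ : H →L[ℂ] H), ha⟩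
    have e : ρ = τ - (τ - ρ) := by abel
    rw [e, map_sub, hpos τ (CFC.abs_nonneg _), hpos (τ - ρ) ?_, sub_zero]
    change 0 ≤ CFC.abs (ρ : H →L[ℂ] H) - (ρ : H →L[ℂ] H)
    rw [CFC.abs_sub_self _ hρ]
    exact smul_nonneg (by norm_num) (CFC.negPart_nonneg _)
  set σ : TraceClass H := ⟨star (ρ : H →L[ℂ] H), ρ.2.star⟩ with hσ
  have h1 : ψ (ρ + σ) = 0 := hself _ (IsSelfAdjoint.add_star_self (ρ : H →L[ℂ] H))
  have h2 : ψ (Complex.I • (ρ - σ)) = 0 := by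
    refine hself _ ?_
    change star (Complex.I • ((ρ : H →L[ℂ] H) - star (ρ : H →L[ℂ] H))) = _
    rw [star_smul, star_sub, star_star]
    change _ = Complex.I • ((ρ : H →L[ℂ] H) - star (ρ : H →L[ℂ] H))
    simp only [RCLike.star_def, Complex.conj_I, smul_sub, neg_smul]
    abel
  rw [map_smul, smul_eq_mul, mul_eq_zero_iff_left Complex.I_ne_zero, map_sub] at h2
  rw [map_add] at h1
  linear_combination (h1 + h2) / 2

lemma ketBra_add_left (y z x : H) : ketBra (y + z) x = ketBra y x + ketBra z x :=
  Subtype.ext (by simp [ketBra])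

lemma ketBra_add_right (y x z : H) : ketBra y (x + z) = ketBra y x + ketBra y z :=
  Subtype.ext (by simp [ketBra])

lemma ketBra_smul_left (c : ℂ) (y x : H) : ketBra (c • y) x = c • ketBra y x :=
  Subtype.ext (by simp [ketBra])

lemma ketBra_smul_right (c : ℂ) (y x : H) : ketBra y (c • x) = starRingEnd ℂ c • ketBra y x :=
  Subtype.ext (by simp [ketBra])

/-- Linear functionals on `T(H)` dominated by the trace on positive operators are of the form
`ρ ↦ tr (D ρ)` with `D` bounded. -/
lemma exists_repr (φ : TraceClass H →ₗ[ℂ] ℂ) {C : ℝ} (hC : 0 ≤ C)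
    (hφ : ∀ ρ : TraceClass H, 0 ≤ (ρ : H →L[ℂ] H) → ‖φ ρ‖ ≤ C * (trace ρ).re) :
    ∃ D : H →L[ℂ] H, ∀ ρ, trace (mulLeft D ρ) = φ ρ := by
  have hdiag : ∀ x, ‖φ (ketBra x x)‖ ≤ C * ‖x‖ ^ 2 := by
    intro x
    refine (hφ _ (ketBra_self_nonneg x)).trans (le_of_eq ?_)
    rw [trace_ketBra, inner_self_eq_norm_sq_to_K]
    norm_cast
  have hunit : ∀ x y : H, ‖x‖ = 1 → ‖y‖ = 1 → ‖φ (ketBra y x)‖ ≤ 4 * C := by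
    intro x y hx hy
    have hpol : (4 : ℂ) * φ (ketBra y x) =
        φ (ketBra (y + x) (y + x)) - φ (ketBra (y + (-1 : ℂ) • x) (y + (-1 : ℂ) • x)) +
        Complex.I * φ (ketBra (y + Complex.I • x) (y + Complex.I • x)) -
        Complex.I * φ (ketBra (y + (-Complex.I) • x) (y + (-Complex.I) • x)) := by
      simp only [ketBra_add_left, ketBra_add_right, ketBra_smul_left, ketBra_smul_right,
        map_add, map_smul, smul_eq_mul, map_neg, Complex.conj_I, map_one]
      linear_combination (2 * φ (ketBra y x) - 2 * φ (ketBra x y)) * Complex.I_sq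
    have hk : ∀ c : ℂ, ‖c‖ = 1 → ‖φ (ketBra (y + c • x) (y + c • x))‖ ≤ C * 4 := by
      intro c hc
      refine (hdiag _).trans (mul_le_mul_of_nonneg_left ?_ hC)
      have : ‖y + c • x‖ ≤ 2 := by
        refine (norm_add_le _ _).trans ?_
        rw [norm_smul, hc, hx, hy]; norm_num
      nlinarith [norm_nonneg (y + c • x)]
    have h1 := hk 1 (by simp)
    rw [one_smul] at h1
    have h2 := hk (-1) (by simp)
    have h3 := hk Complex.I (by simp)
    have h4 := hk (-Complex.I) (by simp)
    have : ‖(4 : ℂ) * φ (ketBra y x)‖ ≤ C * 4 + C * 4 + C * 4 + C * 4 := by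
      rw [hpol]
      refine (norm_sub_le _ _).trans (add_le_add ((norm_add_le _ _).trans
        (add_le_add ((norm_sub_le _ _).trans (add_le_add h1 h2)) ?_)) ?_)
      · simpa using h3
      · simpa using h4
    rw [norm_mul] at this
    norm_num at this
    linarith
  have hbound : ∀ x y : H, ‖φ (ketBra y x)‖ ≤ 4 * C * ‖x‖ * ‖y‖ := by
    intro x y
    by_cases hx : x = 0
    · subst hx
      have : ketBra y (0 : H) = 0 := Subtype.ext (by simp [ketBra])
      simp [this]
    by_cases hy : y = 0
    · subst hy
      have : ketBra (0 : H) x = 0 := Subtype.ext (by simp [ketBra])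
      simp [this]
    have hx' : ‖x‖ ≠ 0 := norm_ne_zero_iff.2 hx
    have hy' : ‖y‖ ≠ 0 := norm_ne_zero_iff.2 hy
    have h := hunit ((‖x‖⁻¹ : ℂ) • x) ((‖y‖⁻¹ : ℂ) • y)
      (by rw [norm_smul]; simp [hx']) (by rw [norm_smul]; simp [hy'])
    rw [ketBra_smul_left, ketBra_smul_right, map_smul, map_smul, norm_smul, norm_smul] at h
    simp only [norm_inv, Complex.norm_real, norm_norm, map_inv₀, Complex.conj_ofReal] at h
    rw [← mul_assoc, ← mul_inv, inv_mul_le_iff₀ (by positivity)] at h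
    linarith
  let B : H →L⋆[ℂ] H →L[ℂ] ℂ := LinearMap.mkContinuous₂
    (LinearMap.mk₂'ₛₗ (starRingEnd ℂ) (RingHom.id ℂ) (fun x y => φ (ketBra y x))
      (fun x z y => by rw [ketBra_add_right, map_add])
      (fun c x y => by rw [ketBra_smul_right, map_smul])
      (fun x y z => by rw [ketBra_add_left, map_add])
      (fun c x y => by rw [ketBra_smul_left, map_smul]; rfl)) (4 * C) hbound
  have hB : ∀ x y, B x y = φ (ketBra y x) := fun x y => rfl
  set D := ContinuousLinearMap.adjoint (InnerProductSpace.continuousLinearMapOfBilin B) with hD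
  have hDi : ∀ x y, ⟪x, D y⟫_ℂ = φ (ketBra y x) := by
    intro x y
    rw [hD, ContinuousLinearMap.adjoint_inner_right,
      InnerProductSpace.continuousLinearMapOfBilin_apply, hB]
  refine ⟨D, fun ρ => ?_⟩
  let τ : TraceClass H →ₗ[ℂ] ℂ :=
    { toFun := trace
      map_add' := trace_add
      map_smul' := trace_smul }
  have := functional_eq_zero (τ ∘ₗ mulLeft D - φ) (‖D‖ + C) (fun ρ hρ => ?_) (fun x => ?_) ρ
  · rw [LinearMap.sub_apply, sub_eq_zero] at this
    exact this
  · rw [LinearMap.sub_apply, add_mul]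
    refine (norm_sub_le _ _).trans (add_le_add ?_ (hφ ρ hρ))
    rw [← traceNorm_of_nonneg hρ]
    exact norm_trace_mulLeft_le D ρ
  · rw [LinearMap.sub_apply, sub_eq_zero, LinearMap.comp_apply, mulLeft_ketBra]
    change trace _ = _
    rw [trace_ketBra, hDi]

/-- A density matrix: a positive trace-class operator of trace one. -/
def IsDensity (ρ : TraceClass H) : Prop := 0 ≤ (ρ : H →L[ℂ] H) ∧ trace ρ = 1

/-- The `n × n` block operator with entries `ρ i j` is positive on the `n`-fold Hilbert sum
of `H`: `⟪x, ρ x⟫` is real and nonnegative for each `x = (x₁, …, xₙ)`. -/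
def IsBlockPositive {n : ℕ} (ρ : Matrix (Fin n) (Fin n) (TraceClass H)) : Prop :=
  ∀ x : Fin n → H, 0 ≤ ∑ i, ∑ j, ⟪x i, (ρ i j : H →L[ℂ] H) (x j)⟫_ℂ

end TraceClass

section Channels

variable {H : Type u} [NormedAddCommGroup H] [InnerProductSpace ℂ H] [CompleteSpace H]
  {K : Type v} [NormedAddCommGroup K] [InnerProductSpace ℂ K] [CompleteSpace K]

/-- Complete positivity of a linear map `T(H) → T(K)`: for every `n`, applying it to all entries
of a positive `n × n` block operator gives a positive block operator. -/
def IsCompletelyPositive (P : TraceClass H →ₗ[ℂ] TraceClass K) : Prop :=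
  ∀ (n : ℕ) (ρ : Matrix (Fin n) (Fin n) (TraceClass H)),
    IsBlockPositive ρ → IsBlockPositive (ρ.map P)

variable (H K) in
/-- Completely positive trace-preserving maps `T(H) → T(K)`. -/
structure Channel where
  /-- the underlying linear map -/
  toLinearMap : TraceClass H →ₗ[ℂ] TraceClass K
  completelyPositive : IsCompletelyPositive toLinearMap
  tracePreserving : ∀ ρ, trace (toLinearMap ρ) = trace ρ

instance : CoeFun (Channel H K) fun _ => TraceClass H → TraceClass K :=
  ⟨fun P => P.toLinearMap⟩

lemma Channel.nonneg (P : Channel H K) {ρ : TraceClass H} (hρ : 0 ≤ (ρ : H →L[ℂ] H)) :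
    0 ≤ (P ρ : K →L[ℂ] K) := by
  have h1 : IsBlockPositive (n := 1) (fun _ _ => ρ) := by
    intro x
    simpa using ((ContinuousLinearMap.nonneg_iff_isPositive _).1 hρ).inner_nonneg_right (x 0)
  have h2 := P.completelyPositive 1 _ h1
  rw [ContinuousLinearMap.nonneg_iff_isPositive, ContinuousLinearMap.isPositive_iff_complex]
  intro x
  have h3 : 0 ≤ ⟪x, (P ρ : K →L[ℂ] K) x⟫_ℂ := by
    have h3 := h2 (fun _ => x)
    rw [Fin.sum_univ_one, Fin.sum_univ_one] at h3
    exact h3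
  have h4 := Complex.nonneg_iff.1 h3
  have h5 : ⟪(P ρ : K →L[ℂ] K) x, x⟫_ℂ = ⟪x, (P ρ : K →L[ℂ] K) x⟫_ℂ := by
    rw [← inner_conj_symm, Complex.conj_eq_iff_im.2 h4.2.symm]
  rw [h5]
  exact ⟨Complex.ext (by simp) (by simpa using h4.2), h4.1⟩

/-- The dual `Pᵗ : L(K) → L(H)` exists: `tr (Pᵗ(T) ρ) = tr (T P(ρ))` for all `ρ ∈ T(H)`. -/
lemma Channel.exists_dual (P : Channel H K) (T : K →L[ℂ] K) :
    ∃ D : H →L[ℂ] H, ∀ ρ, trace (mulLeft D ρ) = trace (mulLeft T (P ρ)) := by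
  let φ : TraceClass H →ₗ[ℂ] ℂ :=
    { toFun := fun ρ => trace (mulLeft T (P ρ))
      map_add' := fun ρ σ => by rw [map_add, map_add, trace_add]
      map_smul' := fun c ρ => by rw [map_smul, map_smul, trace_smul]; rfl }
  refine exists_repr φ (norm_nonneg T) fun ρ hρ => ?_
  refine (norm_trace_mulLeft_le T (P ρ)).trans (le_of_eq ?_)
  rw [traceNorm_of_nonneg (P.nonneg hρ), P.tracePreserving]

/-- The dual map `Pᵗ : L(K) → L(H)`, determined by `tr (Pᵗ(T) ρ) = tr (T P(ρ))` for all
trace-class `ρ`. -/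
noncomputable def Channel.dual (P : Channel H K) (T : K →L[ℂ] K) : H →L[ℂ] H :=
  (P.exists_dual T).choose

lemma Channel.trace_dual (P : Channel H K) (T : K →L[ℂ] K) (ρ : TraceClass H) :
    trace (mulLeft (P.dual T) ρ) = trace (mulLeft T (P ρ)) :=
  (P.exists_dual T).choose_spec ρ

/-- `γ`-damping: `Pᵗ` is within `γ` of an abelian von Neumann algebra. -/
def IsDamped (P : Channel H H) (γ : ℝ) : Prop :=
  ∃ 𝔄 : VonNeumannAlgebra H, (∀ S ∈ 𝔄, ∀ T ∈ 𝔄, S * T = T * S) ∧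
    ∀ T : H →L[ℂ] H, ∃ S ∈ 𝔄, ‖P.dual T - S‖ ≤ γ * ‖T‖

/-- The Quantum Computer Condition with logical space `H` and computational space `K`:
`‖M_dec (P (M_enc ρ)) - U ρ U†‖₁ ≤ α` for all density matrices `ρ`. -/
def QCC (P : Channel K K) (U : unitary (H →L[ℂ] H)) (Menc : Channel H K) (Mdec : Channel K H)
    (α : ℝ) : Prop :=
  ∀ ρ : TraceClass H, IsDensity ρ →
    traceNorm (Mdec (P (Menc ρ)) - conj (U : H →L[ℂ] H) ρ) ≤ α

end Channels

end QuantumComputer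

/-! A logical space with two orthonormal vectors `e`, `f` contains a qubit, and a qubit carries the
three noncommuting Pauli observables. Damping makes the computation reproduce their expectation
values through commuting operators, which is impossible if the errors are small.

For each Pauli direction take its two orthogonal eigenstates `u`, `v` and the observable `T =
|Uu⟩⟨Uu| - |Uv⟩⟨Uv|`. Pulled back through the duals of `Mdec` and `P`, it lies within `γ` of a
self-adjoint `S` in the abelian algebra, with `‖S‖ ≤ 1 + γ`. By the QCC, `S` separates the encoded
states by at least `2 - 2(α + γ)` (`QCC.exists_distinguishing`). The three directions together give
at least `6 - 6(α + γ)`.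

For the opposite bound, put `M = ∑ σₖ ⊗ Sₖ`. Since the `Sₖ` commute, the Pauli relations give `M² =
1 ⊗ ∑ Sₖ²`, bounded by `c²` with `c = √3 (1 + γ)`. Expanding `(c - M)² ≥ 0` against the encoded
block operator `(Menc |eᵢ⟩⟨eⱼ|)`, of total trace 2, bounds the sum by `2c`
(`re_tracePairing_pauli_le`). Positivity of this block operator is where 2-positivity of `Menc`
enters; all other uses of complete positivity are plain positivity.

Hence `6 - 6(α + γ) ≤ 2√3 (1 + γ)`, that is `α + (1 + 1/√3) γ ≥ 1 - 1/√3 ≈ 0.423`. As `γ ≥ 0`, this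
contradicts `α + 2γ < √2/4 ≈ 0.354`. -/

namespace QuantumComputer

open scoped InnerProductSpace ComplexOrder

universe u v

/-! ### Cyclicity of the trace and the pairing of bounded with trace-class operators. -/

section TracePairing

variable {H : Type u} [NormedAddCommGroup H] [InnerProductSpace ℂ H] [CompleteSpace H]

/-- The product `ρ X` of a trace-class and a bounded operator, which is trace class. -/
def mulRight (X : H →L[ℂ] H) : TraceClass H →ₗ[ℂ] TraceClass H where
  toFun ρ := ⟨ρ * X, show IsTraceClass _ by simpa using ρ.2.mul_mul 1 X⟩
  map_add' ρ σ := Subtype.ext (add_mul (ρ : H →L[ℂ] H) σ X)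
  map_smul' c ρ := Subtype.ext (smul_mul_assoc c (ρ : H →L[ℂ] H) X)

lemma norm_trace_mulRight_le (X : H →L[ℂ] H) (ρ : TraceClass H) :
    ‖trace (mulRight X ρ)‖ ≤ ‖X‖ * traceNorm ρ := by
  have hs : ∀ F : Finset (BasisIndex H),
      ∑ i ∈ F, ‖⟪hbasis H i, (ρ : H →L[ℂ] H) (X (hbasis H i))⟫_ℂ‖ ≤ ‖X‖ * traceNorm ρ := by
    intro F
    refine (sum_inner_le ρ.2 1 X F).trans ?_
    have n1 : ‖(1 : H →L[ℂ] H)‖ ≤ 1 := ContinuousLinearMap.norm_id_le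
    exact mul_le_mul_of_nonneg_right (mul_le_of_le_one_left (norm_nonneg _) n1) (trAbs_nonneg _)
  have hsum := summable_of_sum_le (fun _ => norm_nonneg _) hs
  exact (tsum_of_norm_bounded hsum.hasSum fun i => le_rfl).trans
    (Real.tsum_le_of_sum_le (fun _ => norm_nonneg _) hs)

/-- The trace as a linear functional. -/
noncomputable def traceLinear : TraceClass H →ₗ[ℂ] ℂ where
  toFun := trace
  map_add' := trace_add
  map_smul' := trace_smul

lemma mulRight_ketBra (X : H →L[ℂ] H) (y x : H) :
    mulRight X (ketBra y x) = ketBra y (star X x) := by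
  refine Subtype.ext (ContinuousLinearMap.ext fun z => ?_)
  change InnerProductSpace.rankOne ℂ y x (X z) = InnerProductSpace.rankOne ℂ y (star X x) z
  rw [InnerProductSpace.rankOne_apply, InnerProductSpace.rankOne_apply,
    ContinuousLinearMap.star_eq_adjoint, ContinuousLinearMap.adjoint_inner_left]

/-- Cyclicity of the trace. -/
lemma trace_mulRight (X : H →L[ℂ] H) (ρ : TraceClass H) :
    trace (mulRight X ρ) = trace (mulLeft X ρ) := by
  -- Both functionals take the value `⟪x, X x⟫` on `|x⟩⟨x|` and are bounded by `‖X‖ tr ρ` on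
  -- positive `ρ`, so their difference falls under `functional_eq_zero`.
  have := functional_eq_zero (traceLinear ∘ₗ mulRight X - traceLinear ∘ₗ mulLeft X) (‖X‖ + ‖X‖)
    (fun ρ hρ => ?_) (fun x => ?_) ρ
  · rwa [LinearMap.sub_apply, sub_eq_zero] at this
  · rw [LinearMap.sub_apply, add_mul, ← traceNorm_of_nonneg hρ]
    exact (norm_sub_le _ _).trans
      (add_le_add (norm_trace_mulRight_le X ρ) (norm_trace_mulLeft_le X ρ))
  · change trace (mulRight X (ketBra x x)) - trace (mulLeft X (ketBra x x)) = 0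
    rw [mulRight_ketBra, mulLeft_ketBra, trace_ketBra, trace_ketBra,
      ContinuousLinearMap.star_eq_adjoint, ContinuousLinearMap.adjoint_inner_left, sub_self]

/-- The linear functional `X ↦ tr (X ρ)` on bounded operators. -/
noncomputable def tracePairing (ρ : TraceClass H) : (H →L[ℂ] H) →ₗ[ℂ] ℂ where
  toFun X := trace (mulLeft X ρ)
  map_add' X Y := by
    rw [← trace_add]
    exact congrArg trace (Subtype.ext (add_mul X Y (ρ : H →L[ℂ] H)))
  map_smul' c X := by
    rw [RingHom.id_apply, smul_eq_mul, ← trace_smul]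
    exact congrArg trace (Subtype.ext (smul_mul_assoc c X (ρ : H →L[ℂ] H)))

lemma tracePairing_apply (ρ : TraceClass H) (X : H →L[ℂ] H) :
    tracePairing ρ X = trace (mulLeft X ρ) := rfl

lemma tracePairing_add (ρ σ : TraceClass H) (X : H →L[ℂ] H) :
    tracePairing (ρ + σ) X = tracePairing ρ X + tracePairing σ X := by
  simp only [tracePairing_apply, map_add, trace_add]

lemma tracePairing_smul (c : ℂ) (ρ : TraceClass H) (X : H →L[ℂ] H) :
    tracePairing (c • ρ) X = c * tracePairing ρ X := by
  simp only [tracePairing_apply, map_smul, trace_smul]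

lemma tracePairing_sub (ρ σ : TraceClass H) (X : H →L[ℂ] H) :
    tracePairing (ρ - σ) X = tracePairing ρ X - tracePairing σ X := by
  have := tracePairing_add (ρ - σ) σ X
  rw [sub_add_cancel] at this
  rw [this, add_sub_cancel_right]

lemma tracePairing_one (ρ : TraceClass H) : tracePairing ρ 1 = trace ρ :=
  congrArg trace (Subtype.ext (one_mul (ρ : H →L[ℂ] H)))

lemma norm_tracePairing_le (ρ : TraceClass H) (X : H →L[ℂ] H) :
    ‖tracePairing ρ X‖ ≤ ‖X‖ * traceNorm ρ :=
  norm_trace_mulLeft_le X ρ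

lemma tracePairing_ketBra (y x : H) (X : H →L[ℂ] H) :
    tracePairing (ketBra y x) X = ⟪x, X y⟫_ℂ := by
  rw [tracePairing_apply, mulLeft_ketBra, trace_ketBra]

/-- The adjoint of `X ρ` is `ρ X†`, and cyclicity turns its trace into that of `X† ρ`. -/
lemma tracePairing_star {ρ : TraceClass H} (hρ : IsSelfAdjoint (ρ : H →L[ℂ] H)) (X : H →L[ℂ] H) :
    tracePairing ρ (star X) = starRingEnd ℂ (tracePairing ρ X) := by
  rw [tracePairing_apply, tracePairing_apply, ← trace_mulRight]
  unfold trace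
  rw [Complex.conj_tsum]
  refine tsum_congr fun i => ?_
  rw [inner_conj_symm]
  change ⟪hbasis H i, (ρ : H →L[ℂ] H) (star X (hbasis H i))⟫_ℂ =
    ⟪X ((ρ : H →L[ℂ] H) (hbasis H i)), hbasis H i⟫_ℂ
  rw [← ContinuousLinearMap.adjoint_inner_left, hρ.adjoint_eq,
    ContinuousLinearMap.star_eq_adjoint, ContinuousLinearMap.adjoint_inner_right]

/-- A positive block operator pairs nonnegatively with `(Xⱼ Xᵢ†)`. -/
lemma IsBlockPositive.tracePairing_nonneg {n : ℕ} {ρ : Matrix (Fin n) (Fin n) (TraceClass H)}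
    (hρ : IsBlockPositive ρ) (X : Fin n → H →L[ℂ] H) :
    0 ≤ (∑ i, ∑ j, tracePairing (ρ i j) (X j * star (X i))).re := by
  -- Cyclicity produces the sandwich `Xᵢ† ρᵢⱼ Xⱼ`, whose diagonal entries are values of the block
  -- form.
  have e : ∀ i j, tracePairing (ρ i j) (X j * star (X i)) =
      trace (mulLeft (star (X i)) (mulRight (X j) (ρ i j))) := by
    intro i j
    rw [tracePairing_apply, ← trace_mulRight (star (X i)), ← trace_mulRight]
    exact congrArg trace (Subtype.ext (mul_assoc _ _ _).symm)
  simp_rw [e]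
  unfold trace
  have hs : ∀ i j, Summable fun k => ⟪hbasis H k, (mulLeft (star (X i))
      (mulRight (X j) (ρ i j)) : H →L[ℂ] H) (hbasis H k)⟫_ℂ :=
    fun i j => summable_trace_self _
  have hsum : ∑ i, ∑ j, ∑' k, ⟪hbasis H k, (mulLeft (star (X i))
      (mulRight (X j) (ρ i j)) : H →L[ℂ] H) (hbasis H k)⟫_ℂ =
      ∑' k, ∑ i, ∑ j, ⟪hbasis H k, (mulLeft (star (X i))
      (mulRight (X j) (ρ i j)) : H →L[ℂ] H) (hbasis H k)⟫_ℂ := by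
    rw [Summable.tsum_finsetSum fun i _ => summable_sum fun j _ => hs i j]
    exact Finset.sum_congr rfl fun i _ => (Summable.tsum_finsetSum fun j _ => hs i j).symm
  rw [hsum, Complex.re_tsum (summable_sum fun i _ => summable_sum fun j _ => hs i j)]
  refine tsum_nonneg fun k => (Complex.nonneg_iff.1 ?_).1
  -- The `k`-th term is the block form at the vector `(Xᵢ bₖ)ᵢ`, with `bₖ` the `k`-th basis vector.
  refine (hρ fun i => X i (hbasis H k)).trans_eq ?_
  refine Finset.sum_congr rfl fun i _ => Finset.sum_congr rfl fun j _ => ?_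
  change _ = ⟪hbasis H k, star (X i) ((ρ i j : H →L[ℂ] H) (X j (hbasis H k)))⟫_ℂ
  rw [ContinuousLinearMap.star_eq_adjoint, ContinuousLinearMap.adjoint_inner_right]

/-- The quadratic form is `|∑ ⟪xᵢ, eᵢ⟫|²`. For orthonormal `eᵢ` the block operator is an
unnormalised maximally entangled state, so its image under a channel records the action on every
`|eᵢ⟩⟨eⱼ|`. -/
lemma isBlockPositive_ketBra {n : ℕ} (e : Fin n → H) :
    IsBlockPositive (Matrix.of fun i j => ketBra (e i) (e j)) := by
  intro x
  have : ∑ i, ∑ j, ⟪x i, (ketBra (e i) (e j) : H →L[ℂ] H) (x j)⟫_ℂ =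
      (∑ i, ⟪x i, e i⟫_ℂ) * starRingEnd ℂ (∑ i, ⟪x i, e i⟫_ℂ) := by
    rw [map_sum, Finset.sum_mul_sum]
    refine Finset.sum_congr rfl fun i _ => Finset.sum_congr rfl fun j _ => ?_
    change ⟪x i, InnerProductSpace.rankOne ℂ (e i) (e j) (x j)⟫_ℂ = _
    rw [InnerProductSpace.rankOne_apply, inner_smul_right, inner_conj_symm, mul_comm]
  change 0 ≤ ∑ i, ∑ j, ⟪x i, (ketBra (e i) (e j) : H →L[ℂ] H) (x j)⟫_ℂ
  rw [this, Complex.mul_conj]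
  exact_mod_cast Complex.normSq_nonneg _

/-- The norm of a self-adjoint operator is the supremum of its absolute Rayleigh quotients. -/
lemma norm_le_of_abs_inner_le {D : H →L[ℂ] H} (hD : IsSelfAdjoint D) {C : ℝ} (hC : 0 ≤ C)
    (h : ∀ x, ‖⟪x, D x⟫_ℂ‖ ≤ C * ‖x‖ ^ 2) : ‖D‖ ≤ C := by
  rw [ContinuousLinearMap.norm_eq_iSup_rayleighQuotient D hD.isSymmetric]
  refine ciSup_le fun x => ?_
  rw [ContinuousLinearMap.rayleighQuotient, ContinuousLinearMap.reApplyInnerSelf_apply, abs_div,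
    abs_of_nonneg (sq_nonneg ‖x‖)]
  refine div_le_of_le_mul₀ (sq_nonneg _) hC ?_
  refine le_trans ?_ (h x)
  rw [norm_inner_symm]
  exact RCLike.abs_re_le_norm _

lemma traceNorm_ketBra_self (x : H) : traceNorm (ketBra x x) = ‖x‖ ^ 2 := by
  rw [traceNorm_of_nonneg (ketBra_self_nonneg x), trace_ketBra, inner_self_eq_norm_sq_to_K]
  norm_cast

/-- The real part of an operator is at most as far from `T = T†` as the operator itself. -/
lemma norm_sub_realPart_le {T : H →L[ℂ] H} (hT : IsSelfAdjoint T) (S : H →L[ℂ] H) :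
    ‖T - (2⁻¹ : ℂ) • (S + star S)‖ ≤ ‖T - S‖ := by
  have e : T - (2⁻¹ : ℂ) • (S + star S) = (2⁻¹ : ℂ) • ((T - S) + star (T - S)) := by
    rw [star_sub, hT.star_eq]
    module
  rw [e, norm_smul]
  have := norm_add_le (T - S) (star (T - S))
  rw [norm_star] at this
  rw [norm_inv, Complex.norm_ofNat]
  linarith

lemma isSelfAdjoint_realPart (S : H →L[ℂ] H) : IsSelfAdjoint ((2⁻¹ : ℂ) • (S + star S)) := by
  refine IsSelfAdjoint.smul ?_ (IsSelfAdjoint.add_star_self S)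
  simp [isSelfAdjoint_iff]

end TracePairing

/-! ### Dual channels and consequences of damping. -/

section Dual

variable {H : Type u} [NormedAddCommGroup H] [InnerProductSpace ℂ H] [CompleteSpace H]
  {K : Type v} [NormedAddCommGroup K] [InnerProductSpace ℂ K] [CompleteSpace K]

lemma Channel.tracePairing_dual (P : Channel H K) (T : K →L[ℂ] K) (ρ : TraceClass H) :
    tracePairing ρ (P.dual T) = tracePairing (P ρ) T :=
  P.trace_dual T ρ

/-- The quadratic form of the dual at `x` is `tr (T P(|x⟩⟨x|))`, real because `P` preserves
positivity. -/
lemma Channel.isSelfAdjoint_dual (P : Channel H K) {T : K →L[ℂ] K} (hT : IsSelfAdjoint T) :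
    IsSelfAdjoint (P.dual T) := by
  rw [ContinuousLinearMap.isSelfAdjoint_iff_isSymmetric,
    LinearMap.isSymmetric_iff_inner_map_self_real]
  intro x
  have h1 : ⟪x, P.dual T x⟫_ℂ = tracePairing (P (ketBra x x)) T := by
    rw [← tracePairing_ketBra, P.tracePairing_dual]
  have h2 := tracePairing_star (IsSelfAdjoint.of_nonneg (P.nonneg (ketBra_self_nonneg x))) T
  rw [hT.star_eq, ← h1] at h2
  rw [inner_conj_symm]
  refine h2.trans ?_
  rw [inner_conj_symm]
  rfl

/-- Self-adjointness reduces the norm to the quadratic form, where `P(|x⟩⟨x|)` has trace norm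
`‖x‖²`. -/
lemma Channel.norm_dual_le (P : Channel H K) {T : K →L[ℂ] K} (hT : IsSelfAdjoint T) :
    ‖P.dual T‖ ≤ ‖T‖ := by
  refine norm_le_of_abs_inner_le (P.isSelfAdjoint_dual hT) (norm_nonneg T) fun x => ?_
  rw [← tracePairing_ketBra, P.tracePairing_dual]
  refine (norm_tracePairing_le _ _).trans_eq ?_
  rw [traceNorm_of_nonneg (P.nonneg (ketBra_self_nonneg x)), P.tracePreserving,
    ← traceNorm_of_nonneg (ketBra_self_nonneg x), traceNorm_ketBra_self]

lemma IsDamped.exists_isSelfAdjoint {P : Channel H H} {γ : ℝ} (hP : IsDamped P γ) :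
    ∃ 𝔄 : VonNeumannAlgebra H, (∀ S ∈ 𝔄, ∀ T ∈ 𝔄, S * T = T * S) ∧
      ∀ T : H →L[ℂ] H, IsSelfAdjoint T →
        ∃ S ∈ 𝔄, IsSelfAdjoint S ∧ ‖P.dual T - S‖ ≤ γ * ‖T‖ := by
  obtain ⟨𝔄, hcomm, h⟩ := hP
  refine ⟨𝔄, hcomm, fun T hT => ?_⟩
  obtain ⟨S, hS, hST⟩ := h T
  exact ⟨(2⁻¹ : ℂ) • (S + star S), 𝔄.toStarSubalgebra.smul_mem (add_mem hS (star_mem hS)) _,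
    isSelfAdjoint_realPart S, (norm_sub_realPart_le (P.isSelfAdjoint_dual hT) S).trans hST⟩

/-- The damping bound at `T = 1`. A nonzero space is essential: otherwise `‖1‖ = 0`, and the bound
says nothing about the sign of `γ`. -/
lemma IsDamped.nonneg [Nontrivial H] {P : Channel H H} {γ : ℝ} (hP : IsDamped P γ) : 0 ≤ γ := by
  obtain ⟨𝔄, -, h⟩ := hP
  obtain ⟨S, -, hS⟩ := h 1
  rw [norm_one, mul_one] at hS
  exact (norm_nonneg _).trans hS

/-- On the zero space every trace vanishes, while a nonzero `|x⟩⟨x|` has nonzero trace. -/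
lemma Channel.nontrivial [Nontrivial H] (P : Channel H K) : Nontrivial K := by
  by_contra hK
  rw [not_nontrivial_iff_subsingleton] at hK
  obtain ⟨x, hx⟩ := exists_ne (0 : H)
  have h1 := P.tracePreserving (ketBra x x)
  rw [trace_ketBra] at h1
  refine inner_self_ne_zero.2 hx (h1.symm.trans ?_)
  unfold trace
  simp [Subsingleton.elim (hbasis K _) 0]

end Dual

/-! ### Orthonormal pairs and the eigenvectors of the Pauli matrices. -/

section OrthonormalPairs

variable {H : Type u} [NormedAddCommGroup H] [InnerProductSpace ℂ H]

/-- If the line through a unit vector is not everything, its orthogonal complement is nonzero.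
Infinite dimension, where `finrank` is 0, needs no separate treatment. -/
lemma exists_orthonormal_pair [Nontrivial H] (h : Module.finrank ℂ H ≠ 1) :
    ∃ e f : H, ‖e‖ = 1 ∧ ‖f‖ = 1 ∧ ⟪e, f⟫_ℂ = 0 := by
  obtain ⟨e, he⟩ := exists_norm_eq H zero_le_one
  have he0 : e ≠ 0 := by rintro rfl; simp at he
  have : (ℂ ∙ e)ᗮ ≠ ⊥ := by
    rw [Ne, Submodule.orthogonal_eq_bot_iff]
    intro htop
    exact h ((finrank_eq_one_iff_of_nonzero e he0).2 htop)
  obtain ⟨g, hg, hg0⟩ := Submodule.exists_mem_ne_zero_of_ne_bot this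
  have hn : ‖g‖ ≠ 0 := norm_ne_zero_iff.2 hg0
  refine ⟨e, (‖g‖⁻¹ : ℂ) • g, he, by rw [norm_smul]; simp [hn], ?_⟩
  rw [inner_smul_right, Submodule.mem_orthogonal_singleton_iff_inner_right.1 hg, mul_zero]

/-- By Pythagoras the image of `x` has squared norm `|⟪u, x⟫|² + |⟪v, x⟫|²`, and Bessel applies; the
triangle inequality would only give 2. -/
lemma norm_rankOne_sub_rankOne_le {u v : H} (hu : ‖u‖ = 1) (hv : ‖v‖ = 1) (huv : ⟪u, v⟫_ℂ = 0) :
    ‖InnerProductSpace.rankOne ℂ u u - InnerProductSpace.rankOne ℂ v v‖ ≤ 1 := by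
  refine ContinuousLinearMap.opNorm_le_bound _ zero_le_one fun x => ?_
  rw [one_mul, sub_apply, InnerProductSpace.rankOne_apply, InnerProductSpace.rankOne_apply]
  have ho : Orthonormal ℂ ![u, v] := by
    rw [orthonormal_iff_ite]
    have hvu : ⟪v, u⟫_ℂ = 0 := inner_eq_zero_symm.1 huv
    intro i j
    fin_cases i <;> fin_cases j <;> simp [hu, hv, huv, hvu, inner_self_eq_norm_sq_to_K]
  have hb := ho.sum_inner_products_le x (s := Finset.univ)
  rw [Fin.sum_univ_two] at hb
  refine (sq_le_sq₀ (norm_nonneg _) (norm_nonneg x)).1 ?_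
  rw [norm_sub_sq (𝕜 := ℂ), inner_smul_left, inner_smul_right, huv, norm_smul, norm_smul, hu, hv]
  simpa using hb

lemma norm_balanced {e f : H} (he : ‖e‖ = 1) (hf : ‖f‖ = 1) (hef : ⟪e, f⟫_ℂ = 0) {ω : ℂ}
    (hω : ‖ω‖ = 1) : ‖((√2 : ℝ) : ℂ)⁻¹ • (e + ω • f)‖ = 1 := by
  have h : ‖e + ω • f‖ ^ 2 = 2 := by
    rw [norm_add_sq (𝕜 := ℂ), inner_smul_right, hef, norm_smul, he, hf, hω]
    norm_num
  rw [norm_smul, norm_inv, Complex.norm_real, Real.norm_of_nonneg (Real.sqrt_nonneg 2),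
    ← Real.sqrt_sq (norm_nonneg (e + ω • f)), h, inv_mul_cancel₀ (by positivity)]

lemma inner_balanced {e f : H} (he : ‖e‖ = 1) (hf : ‖f‖ = 1) (hef : ⟪e, f⟫_ℂ = 0) {ω : ℂ}
    (hω : ‖ω‖ = 1) :
    ⟪((√2 : ℝ) : ℂ)⁻¹ • (e + ω • f), ((√2 : ℝ) : ℂ)⁻¹ • (e + (-ω) • f)⟫_ℂ = 0 := by
  have hfe : ⟪f, e⟫_ℂ = 0 := inner_eq_zero_symm.1 hef
  have h : ⟪e + ω • f, e + (-ω) • f⟫_ℂ = 0 := by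
    simp only [inner_add_left, inner_add_right, inner_smul_left, inner_smul_right, hef, hfe,
      inner_self_eq_norm_sq_to_K, he, hf]
    have := Complex.conj_mul' ω
    rw [hω] at this
    simp only [Complex.coe_algebraMap, Complex.ofReal_one] at this ⊢
    linear_combination -this
  rw [inner_smul_left, inner_smul_right, h, mul_zero, mul_zero]

end OrthonormalPairs

/-! ### Logical observables seen through the damping algebra. -/

section Logical

variable {H : Type u} [NormedAddCommGroup H] [InnerProductSpace ℂ H] [CompleteSpace H]
  {K : Type v} [NormedAddCommGroup K] [InnerProductSpace ℂ K] [CompleteSpace K]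

lemma conj_ketBra_self (X : H →L[ℂ] H) (x : H) :
    conj X (ketBra x x) = ketBra (X x) (X x) := by
  have : conj X (ketBra x x) = mulLeft X (mulRight (star X) (ketBra x x)) :=
    Subtype.ext (mul_assoc _ _ _)
  rw [this, mulRight_ketBra, mulLeft_ketBra, star_star]

lemma isDensity_ketBra_self {x : H} (hx : ‖x‖ = 1) : IsDensity (ketBra x x) := by
  refine ⟨ketBra_self_nonneg x, ?_⟩
  rw [trace_ketBra, inner_self_eq_norm_sq_to_K, hx]
  simp

/-- Error of the encoded expectation values of a state. -/
lemma QCC.norm_tracePairing_sub_le {P : Channel K K} {U : unitary (H →L[ℂ] H)}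
    {Menc : Channel H K} {Mdec : Channel K H} {α δ : ℝ} (hQ : QCC P U Menc Mdec α)
    {T : H →L[ℂ] H} (hT1 : ‖T‖ ≤ 1) {S : K →L[ℂ] K} (hS : ‖P.dual (Mdec.dual T) - S‖ ≤ δ)
    {x : H} (hx : ‖x‖ = 1) :
    ‖tracePairing (Menc (ketBra x x)) S - ⟪(U : H →L[ℂ] H) x, T ((U : H →L[ℂ] H) x)⟫_ℂ‖
      ≤ α + δ := by
  -- Replacing `S` by the pulled-back observable costs `δ`, as the encoded state has trace norm one;
  -- that observable measures `T` on the decoded output, where the QCC costs `α`.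
  have h1 : tracePairing (Menc (ketBra x x)) S - ⟪(U : H →L[ℂ] H) x, T ((U : H →L[ℂ] H) x)⟫_ℂ =
      tracePairing (Mdec (P (Menc (ketBra x x))) - conj (U : H →L[ℂ] H) (ketBra x x)) T -
      tracePairing (Menc (ketBra x x)) (P.dual (Mdec.dual T) - S) := by
    rw [tracePairing_sub, map_sub, P.tracePairing_dual, Mdec.tracePairing_dual, conj_ketBra_self,
      tracePairing_ketBra]
    ring
  rw [h1]
  refine (norm_sub_le _ _).trans (add_le_add ?_ ?_)
  · have h2 := hQ _ (isDensity_ketBra_self hx)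
    refine (norm_tracePairing_le _ _).trans ((mul_le_of_le_one_left ?_ hT1).trans h2)
    exact trAbs_nonneg _
  · refine (norm_tracePairing_le _ _).trans ?_
    rw [traceNorm_of_nonneg (Menc.nonneg (ketBra_self_nonneg x)), Menc.tracePreserving,
      (isDensity_ketBra_self hx).2, Complex.one_re, mul_one]
    exact hS

/-- A pair of orthogonal logical states is distinguished by a self-adjoint element of the damping
algebra. -/
lemma QCC.exists_distinguishing {P : Channel K K} {U : unitary (H →L[ℂ] H)}
    {Menc : Channel H K} {Mdec : Channel K H} {α γ : ℝ} (hQ : QCC P U Menc Mdec α) (hγ : 0 ≤ γ)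
    {𝔄 : VonNeumannAlgebra K} (hP : ∀ T : K →L[ℂ] K, IsSelfAdjoint T →
      ∃ S ∈ 𝔄, IsSelfAdjoint S ∧ ‖P.dual T - S‖ ≤ γ * ‖T‖)
    {u v : H} (hu : ‖u‖ = 1) (hv : ‖v‖ = 1) (huv : ⟪u, v⟫_ℂ = 0) :
    ∃ S ∈ 𝔄, IsSelfAdjoint S ∧ ‖S‖ ≤ 1 + γ ∧
      2 - 2 * (α + γ) ≤ (tracePairing (Menc (ketBra u u - ketBra v v)) S).re := by
  have hUi : ∀ x y : H, ⟪(U : H →L[ℂ] H) x, (U : H →L[ℂ] H) y⟫_ℂ = ⟪x, y⟫_ℂ :=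
    fun x y => (Unitary.linearIsometryEquiv U).inner_map_map x y
  have hUn : ∀ x : H, ‖(U : H →L[ℂ] H) x‖ = ‖x‖ :=
    fun x => (Unitary.linearIsometryEquiv U).norm_map x
  set u' := (U : H →L[ℂ] H) u with hu'
  set v' := (U : H →L[ℂ] H) v with hv'
  -- `T` has expectation `1` in `U u` and `-1` in `U v`: an ideal gap of 2, of which each state may
  -- lose `α + γ`.
  set T : H →L[ℂ] H := InnerProductSpace.rankOne ℂ u' u' - InnerProductSpace.rankOne ℂ v' v' with hT
  have hTs : IsSelfAdjoint T := (InnerProductSpace.isPositive_rankOne_self u').isSelfAdjoint.sub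
    (InnerProductSpace.isPositive_rankOne_self v').isSelfAdjoint
  have hT1 : ‖T‖ ≤ 1 := norm_rankOne_sub_rankOne_le ((hUn u).trans hu) ((hUn v).trans hv)
    ((hUi u v).trans huv)
  have hT' : ‖Mdec.dual T‖ ≤ 1 := (Mdec.norm_dual_le hTs).trans hT1
  have hTs' := Mdec.isSelfAdjoint_dual hTs
  obtain ⟨S, hSA, hSs, hS⟩ := hP _ hTs'
  have hS' : ‖P.dual (Mdec.dual T) - S‖ ≤ γ := hS.trans (mul_le_of_le_one_right hγ hT')
  refine ⟨S, hSA, hSs, ?_, ?_⟩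
  · have e : S = P.dual (Mdec.dual T) - (P.dual (Mdec.dual T) - S) := by abel
    rw [e]
    exact (norm_sub_le _ _).trans (add_le_add ((P.norm_dual_le hTs').trans hT') hS')
  · have huu : ⟪u', u'⟫_ℂ = 1 := by rw [hu', hUi, inner_self_eq_norm_sq_to_K, hu]; simp
    have hvv : ⟪v', v'⟫_ℂ = 1 := by rw [hv', hUi, inner_self_eq_norm_sq_to_K, hv]; simp
    have huv' : ⟪u', v'⟫_ℂ = 0 := (hUi u v).trans huv
    have hvu' : ⟪v', u'⟫_ℂ = 0 := inner_eq_zero_symm.1 huv'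
    have h1 := hQ.norm_tracePairing_sub_le hT1 hS' hu
    have h2 := hQ.norm_tracePairing_sub_le hT1 hS' hv
    have e1 : ⟪u', T u'⟫_ℂ = 1 := by
      rw [hT, sub_apply, InnerProductSpace.rankOne_apply, InnerProductSpace.rankOne_apply,
        huu, hvu', zero_smul, one_smul, sub_zero, huu]
    have e2 : ⟪v', T v'⟫_ℂ = -1 := by
      rw [hT, sub_apply, InnerProductSpace.rankOne_apply, InnerProductSpace.rankOne_apply,
        hvv, huv', zero_smul, one_smul, zero_sub, inner_neg_right, hvv]
    rw [← hu', e1] at h1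
    rw [← hv', e2] at h2
    have h1' := (abs_le.1 ((Complex.abs_re_le_norm _).trans h1)).1
    have h2' := (abs_le.1 ((Complex.abs_re_le_norm _).trans h2)).2
    rw [Complex.sub_re, Complex.one_re] at h1'
    rw [Complex.sub_re, Complex.neg_re, Complex.one_re] at h2'
    rw [map_sub, tracePairing_sub, Complex.sub_re]
    linarith

/-! ### The Pauli inequality for commuting operators. -/

/-- Commuting self-adjoint operators of norm at most `c/√3` cannot reproduce the three Pauli
observables better than by a factor `1/√3`. -/
lemma re_tracePairing_pauli_le {ρ : Matrix (Fin 2) (Fin 2) (TraceClass K)}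
    (hρ : IsBlockPositive ρ) {S₁ S₂ S₃ : K →L[ℂ] K} (h₁ : IsSelfAdjoint S₁)
    (h₂ : IsSelfAdjoint S₂) (h₃ : IsSelfAdjoint S₃) (h₁₂ : S₁ * S₂ = S₂ * S₁)
    (h₁₃ : S₁ * S₃ = S₃ * S₁) (h₂₃ : S₂ * S₃ = S₃ * S₂) {c : ℝ} (hc : 0 < c)
    (hn₁ : 3 * ‖S₁‖ ^ 2 ≤ c ^ 2) (hn₂ : 3 * ‖S₂‖ ^ 2 ≤ c ^ 2) (hn₃ : 3 * ‖S₃‖ ^ 2 ≤ c ^ 2)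
    (hρ₀ : trace (ρ 0 0) = 1) (hρ₁ : trace (ρ 1 1) = 1)
    (hρ₀' : traceNorm (ρ 0 0) = 1) (hρ₁' : traceNorm (ρ 1 1) = 1) :
    (tracePairing (ρ 0 1 + ρ 1 0) S₁).re +
      (tracePairing (Complex.I • (ρ 1 0 - ρ 0 1)) S₂).re +
      (tracePairing (ρ 0 0 - ρ 1 1) S₃).re ≤ 2 * c := by
  -- The two families are the rows of `c - M`, where `M` has rows `(S₃, S₁ - i S₂)` and `(S₁ + i S₂,
  -- -S₃)`; `hp` and `hq` add up to the pairing of `ρ` with `(c - M)²`.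
  have hp := hρ.tracePairing_nonneg ![(c : ℂ) • 1 - S₃, -(S₁ - Complex.I • S₂)]
  have hq := hρ.tracePairing_nonneg ![-(S₁ + Complex.I • S₂), (c : ℂ) • 1 + S₃]
  have hI : IsSelfAdjoint (c : ℂ) := Complex.conj_ofReal c
  have hD : ∀ σ : TraceClass K, traceNorm σ = 1 →
      (tracePairing σ (S₁ * S₁)).re + (tracePairing σ (S₂ * S₂)).re +
        (tracePairing σ (S₃ * S₃)).re ≤ c ^ 2 := by
    intro σ hσ
    have hS : ∀ S : K →L[ℂ] K, (tracePairing σ (S * S)).re ≤ ‖S‖ ^ 2 := by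
      intro S
      refine (Complex.re_le_norm _).trans ((norm_tracePairing_le _ _).trans ?_)
      rw [hσ, mul_one, sq]
      exact norm_mul_le _ _
    linarith [hS S₁, hS S₂, hS S₃]
  have hD₀ := hD _ hρ₀'
  have hD₁ := hD _ hρ₁'
  -- The commutation relations put mixed products in a single order. Those of `S₁` and `S₂` then
  -- cancel inside each diagonal entry, and those involving `S₃` cancel between `hp` and `hq`,
  -- leaving `c² - 2cM + ∑ Sₖ²`.
  simp only [Fin.sum_univ_two, Matrix.cons_val_zero, Matrix.cons_val_one, star_sub, star_neg,
    star_add, star_smul, h₁.star_eq, h₂.star_eq, h₃.star_eq, star_one, hI.star_eq, mul_sub, sub_mul,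
    mul_add, add_mul, mul_neg, neg_mul, smul_mul_assoc, mul_smul_comm, one_mul, mul_one, map_sub,
    map_add, map_neg, map_smul, smul_eq_mul, h₁₂, h₁₃, h₂₃, tracePairing_one, hρ₀, hρ₁,
    RCLike.star_def, Complex.conj_I] at hp hq
  simp only [tracePairing_add, tracePairing_smul, tracePairing_sub]
  simp at hp hq hD₀ hD₁ ⊢
  nlinarith

/-- The diagonal terms cancel. What remains is the Pauli matrix `σₓ` on the span of `e`, `f` for `ω
= 1`, and `σ_y` for `ω = i`. -/
lemma ketBra_balanced_sub (e f : H) (ω : ℂ) :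
    ketBra (((√2 : ℝ) : ℂ)⁻¹ • (e + ω • f)) (((√2 : ℝ) : ℂ)⁻¹ • (e + ω • f)) -
      ketBra (((√2 : ℝ) : ℂ)⁻¹ • (e + (-ω) • f)) (((√2 : ℝ) : ℂ)⁻¹ • (e + (-ω) • f)) =
      starRingEnd ℂ ω • ketBra e f + ω • ketBra f e := by
  have h2 : ((√2 : ℝ) : ℂ)⁻¹ * ((√2 : ℝ) : ℂ)⁻¹ = 2⁻¹ := by
    rw [← mul_inv, ← Complex.ofReal_mul, Real.mul_self_sqrt zero_le_two, Complex.ofReal_ofNat]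
  simp only [ketBra_smul_left, ketBra_smul_right, ketBra_add_left, ketBra_add_right, map_inv₀,
    Complex.conj_ofReal, map_neg]
  match_scalars
  · ring
  · linear_combination 2 * ω * h2
  · linear_combination 2 * starRingEnd ℂ ω * h2
  · ring

end Logical

end QuantumComputer

/-! ### The contradiction between the two bounds. -/

open QuantumComputer in
theorem theorem1 {Hlogical : Type*} [NormedAddCommGroup Hlogical] [InnerProductSpace ℂ Hlogical]
    [CompleteSpace Hlogical] [Nontrivial Hlogical]
    {Hcomp : Type*} [NormedAddCommGroup Hcomp] [InnerProductSpace ℂ Hcomp] [CompleteSpace Hcomp]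
    (P : QuantumComputer.Channel Hcomp Hcomp) (U : unitary (Hlogical →L[ℂ] Hlogical))
    (Menc : QuantumComputer.Channel Hlogical Hcomp)
    (Mdec : QuantumComputer.Channel Hcomp Hlogical) (α γ : ℝ)
    (hQCC : QuantumComputer.QCC P U Menc Mdec α) (hP : QuantumComputer.IsDamped P γ)
    (h : 2 * γ + α < Real.sqrt 2 / 4) :
    Module.finrank ℂ Hlogical = 1 := by
  by_contra hdim
  obtain ⟨e, f, he, hf, hef⟩ := exists_orthonormal_pair hdim
  have : Nontrivial Hcomp := Menc.nontrivial
  have hγ := hP.nonneg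
  obtain ⟨𝔄, hcomm, h𝔄⟩ := hP.exists_isSelfAdjoint
  obtain ⟨S₁, m₁, s₁, n₁, b₁⟩ := hQCC.exists_distinguishing hγ h𝔄
    (norm_balanced he hf hef (ω := 1) (by simp))
    (norm_balanced he hf hef (ω := -1) (by simp))
    (inner_balanced he hf hef (ω := 1) (by simp))
  obtain ⟨S₂, m₂, s₂, n₂, b₂⟩ := hQCC.exists_distinguishing hγ h𝔄
    (norm_balanced he hf hef (ω := Complex.I) (by simp))
    (norm_balanced he hf hef (ω := -Complex.I) (by simp))
    (inner_balanced he hf hef (ω := Complex.I) (by simp))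
  obtain ⟨S₃, m₃, s₃, n₃, b₃⟩ := hQCC.exists_distinguishing hγ h𝔄 he hf hef
  rw [ketBra_balanced_sub] at b₁ b₂
  -- Positivity on single states would not control the off-diagonal blocks `Menc |e⟩⟨f|` jointly
  -- with the diagonal ones.
  have hbp := Menc.completelyPositive 2 _ (isBlockPositive_ketBra ![e, f])
  have hsq : √3 * √3 = (3 : ℝ) := Real.mul_self_sqrt (by norm_num)
  have hn : ∀ S : Hcomp →L[ℂ] Hcomp, ‖S‖ ≤ 1 + γ → 3 * ‖S‖ ^ 2 ≤ (√3 * (1 + γ)) ^ 2 := by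
    intro S hS
    rw [mul_pow, sq √3, hsq]
    gcongr
  have htr : ∀ x : Hlogical, ‖x‖ = 1 → trace (Menc (ketBra x x)) = 1 := fun x hx => by
    rw [Menc.tracePreserving, (isDensity_ketBra_self hx).2]
  have htn : ∀ x : Hlogical, ‖x‖ = 1 → traceNorm (Menc (ketBra x x)) = 1 := fun x hx => by
    rw [traceNorm_of_nonneg (Menc.nonneg (ketBra_self_nonneg x)), htr x hx, Complex.one_re]
  have key := re_tracePairing_pauli_le hbp s₁ s₂ s₃ (hcomm _ m₁ _ m₂) (hcomm _ m₁ _ m₃)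
    (hcomm _ m₂ _ m₃) (c := √3 * (1 + γ)) (by positivity) (hn _ n₁) (hn _ n₂) (hn _ n₃)
    (htr e he) (htr f hf) (htn e he) (htn f hf)
  have k₁ : Menc (starRingEnd ℂ 1 • ketBra e f + (1 : ℂ) • ketBra f e) =
      Menc (ketBra e f) + Menc (ketBra f e) := by simp
  have k₂ : Menc (starRingEnd ℂ Complex.I • ketBra e f + Complex.I • ketBra f e) =
      Complex.I • (Menc (ketBra f e) - Menc (ketBra e f)) := by
    rw [map_add, map_smul, map_smul, Complex.conj_I]
    module
  rw [k₁] at b₁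
  rw [k₂] at b₂
  rw [map_sub] at b₃
  replace key := (add_le_add (add_le_add b₁ b₂) b₃).trans key
  -- Now `6 - 6(α + γ) ≤ 2√3 (1 + γ)`. These decimals leave ample room: it would force `2.53 < 6α +
  -- 9.47γ ≤ 6(α + 2γ) < 2.13`.
  have hs3 : √3 < (1.7321 : ℝ) := by rw [Real.sqrt_lt' (by norm_num)]; norm_num
  have hs2 : √2 < (1.4143 : ℝ) := by rw [Real.sqrt_lt' (by norm_num)]; norm_num
  nlinarith
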